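/- **Conventions.** Points $z\ne0$ of the Riemann surface of $\log z$ are identified with their logarithms $s=\log z\in\mathbf C$, so that $z=e^s$ and $\arg z=\operatorname{Im}s$; the branch point $z=0$ is added to this surface. Let $E$ be either (i) a compact set in $\mathbf C\setminus(-\infty,0)$ with $0$ on its boundary, regarded as a subset of the surface by means of the standard branch of $\log z$; or (ii) a compact multilevel surface wrapping around $0$ a finite number of times, i.e. a subset of the surface that contains the branch point $0$, whose set of logarithms of nonzero points is closed in $\mathbf C$, and on which $|z|$ and $|\arg z|$ are bounded. **Hypotheses on $f$.** Let $f$ be a function on $E$ that is analytic in the interior of $E$ and extends analytically to a neighborhood of each boundary point of $E$ other than $0$. Let $\tilde f$ be the multivalued function obtained from an analytic function element on the surface by analytic continuation along curves in the $z$-plane that avoid $0$. Suppose: (a) (branch point at $0$) for some $r,\tau>0$, the element is centered at a point of the region $W=\{0<|z|<r,\ |\arg z|\le|z|^{-\tau}\}$ of the surface and can be continued along every curve in $W$; $\tilde f$ extends $f$ there, i.e. at each point of $E$ in $W$ it agrees with $f$ on $E$ nearby; and for some constants $a,b,c>0$ $$|\tilde f(z)-f(0)|\le c\,|z|^{a}\,(1+|\arg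 z|^{b})\qquad(z\in W);$$ (b) the element can be continued along all curves in the $z$-plane avoiding $0$; $\tilde f$ extends $f$ at all points of $E\setminus\{0\}$; and for some constants $a',b',c'>0$ $$|\tilde f(z)|\le c'\,(1+|z|^{a'})(1+|\arg z|^{b'})$$ at all points $z\neq 0$ of the surface. **Conclusion.** There is $\sigma_0>0$ such that for each $\sigma\in(0,\sigma_0)$ there are constants $C>0$ and $K$ with the following property: for every integer $n\ge0$ there is a polynomial $p$ of degree at most $n$ such that the function $$g(z)=p\!\left(\frac1{\log z-\sigma n}\right),\qquad g(0)=p(0),$$ satisfies $$\sup_{z\in E}|f(z)-g(z)|\le K\,e^{-Cn},$$ and, unless $p$ is constant, $\log z\ne\sigma n$ for all nonzero $z\in E$. (In case (i) $\log$ is the standard branch; in case (ii) it is the logarithm on the surface. In particular, after decreasing $C$, the error is at most $e^{-Cn}$ for all sufficiently large $n$.) -/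

import Mathlib

open Filter Topology Set

namespace RecipLog

/-- The Riemann surface of `log z` together with its branch point. `some s` is the point lying over
`z = exp s ≠ 0` on the sheet where `log z = s` and `arg z = Im s`; `none` is the branch point
`z = 0`. -/
abbrev LogSurface := Option ℂ

/-- The projection of the surface to the `z`-plane. -/
noncomputable def proj : LogSurface → ℂ
  | none => 0
  | some s => Complex.exp s

open Classical in
/-- The principal sheet: `z ≠ 0` is sent to the point with the standard value of `log z`. -/
noncomputable def principal (z : ℂ) : LogSurface :=
  if z = 0 then none else some (Complex.log z)

/-- A compact multilevel surface that contains the branch point `0` and wraps around it a finite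
number of times, given as a subset of the surface of the logarithm: closed, with `|z|` and `|arg z|`
bounded. -/
structure IsCompactMultilevel (E : Set LogSurface) : Prop where
  zero_mem : none ∈ E
  closed : IsClosed {s : ℂ | some s ∈ E}
  bounded : ∃ R : ℝ, ∀ s : ℂ, some s ∈ E → ‖Complex.exp s‖ ≤ R
  finite_wrapping : ∃ L : ℝ, ∀ s : ℂ, some s ∈ E → |s.im| ≤ L

/-- A function element on the surface: a base point `base` (a value of `log z`) and a function of
`z` that is analytic at the point `exp base` of the plane. Its analytic continuations form a
multivalued analytic function. -/
structure FunctionElement where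
  base : ℂ
  toFun : ℂ → ℂ
  analyticAt : AnalyticAt ℂ toFun (Complex.exp base)

/-- The functions `φ t` form an analytic continuation along a curve in the `z`-plane that avoids
`0`. The curve is `t ↦ exp (γ t)`, given with a continuous choice `γ` of its logarithm (so that
`arg z` along the curve is `Im (γ t)`); every curve that avoids `0` has such a choice. -/
structure IsContinuationAlong {s₀ s₁ : ℂ} (γ : Path s₀ s₁) (φ : unitInterval → ℂ → ℂ) : Prop where
  analyticAt : ∀ t, AnalyticAt ℂ (φ t) (Complex.exp (γ t))
  coherent : ∀ t, ∀ᶠ u in 𝓝 t, φ u =ᶠ[𝓝 (Complex.exp (γ u))] φ t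

/-- The element `e` can be continued analytically along every curve that starts at its base point
and stays in the part `W` of the surface. -/
def FunctionElement.ContinuableIn (e : FunctionElement) (W : Set ℂ) : Prop :=
  ∀ (s : ℂ) (γ : Path e.base s), (∀ t, γ t ∈ W) →
    ∃ φ, IsContinuationAlong γ φ ∧ φ 0 =ᶠ[𝓝 (Complex.exp e.base)] e.toFun

/-- `ψ` is a function of `z`, analytic near `exp s`, that results from the element `e` by analytic
continuation along a curve in `W` from the base point to the point `s` of the surface. Thus
`ψ (exp s)` is the value at `s` of the multivalued function generated by `e`. -/
def FunctionElement.ContinuesTo (e : FunctionElement) (W : Set ℂ) (s : ℂ) (ψ : ℂ → ℂ) : Prop :=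
  ∃ γ : Path e.base s, (∀ t, γ t ∈ W) ∧
    ∃ φ, IsContinuationAlong γ φ ∧ φ 0 =ᶠ[𝓝 (Complex.exp e.base)] e.toFun ∧
      φ 1 =ᶠ[𝓝 (Complex.exp s)] ψ

/-- The multivalued function generated by `e` by continuation in `W` is a continuation of the
function `f` on `E`: at each point of `E` in `W`, a branch of it agrees with `f` on `E` nearby. -/
def Extends (e : FunctionElement) (W : Set ℂ) (E : Set LogSurface) (f : LogSurface → ℂ) : Prop :=
  ∀ s ∈ W, some s ∈ E → ∃ ψ, e.ContinuesTo W s ψ ∧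
    ∀ᶠ s' in 𝓝[{s' : ℂ | some s' ∈ E}] s, f (some s') = ψ (Complex.exp s')

/-- The points of the surface with `|z| < r` and `|arg z| ≤ |z| ^ (-τ)`. -/
def wedge (r τ : ℝ) : Set ℂ :=
  {s | ‖Complex.exp s‖ < r ∧ |s.im| ≤ ‖Complex.exp s‖ ^ (-τ)}

/-- `f` is analytic on `E` apart from `0`: it is analytic in the interior and extends analytically
to a neighbourhood of each boundary point other than `0`. -/
def IsAnalyticOffZero (E : Set LogSurface) (f : LogSurface → ℂ) : Prop :=
  ∀ s : ℂ, some s ∈ E → ∃ G : ℂ → ℂ, AnalyticAt ℂ G (Complex.exp s) ∧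
    ∀ᶠ s' in 𝓝[{s' : ℂ | some s' ∈ E}] s, f (some s') = G (Complex.exp s')

/-- `f` is analytic on `E` with a branch point singularity at `0`, where the multivalued
continuation of `f` near `0` is the one generated by the element `e`. -/
def IsAnalyticWithBranchPoint (E : Set LogSurface) (f : LogSurface → ℂ) (e : FunctionElement) :
    Prop :=
  IsAnalyticOffZero E f ∧
  ∃ r > 0, ∃ τ > 0, e.base ∈ wedge r τ ∧ e.ContinuableIn (wedge r τ) ∧ Extends e (wedge r τ) E f ∧
    ∃ a > 0, ∃ b > 0, ∃ c > 0, ∀ s ∈ wedge r τ, ∀ ψ, e.ContinuesTo (wedge r τ) s ψ →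
      ‖ψ (Complex.exp s) - f none‖ ≤ c * ‖Complex.exp s‖ ^ (a : ℝ) * (1 + |s.im| ^ (b : ℝ))

/-- `f` continues analytically along all curves that avoid `0`, to the multivalued function
generated by `e`, with at most polynomial growth in `|z|` and `|arg z|`. -/
def HasGlobalContinuation (E : Set LogSurface) (f : LogSurface → ℂ) (e : FunctionElement) : Prop :=
  e.ContinuableIn univ ∧ Extends e univ E f ∧
    ∃ a > 0, ∃ b > 0, ∃ c > 0, ∀ s ψ, e.ContinuesTo univ s ψ →
      ‖ψ (Complex.exp s)‖ ≤ c * (1 + ‖Complex.exp s‖ ^ (a : ℝ)) * (1 + |s.im| ^ (b : ℝ))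

/-- The function `z ↦ p (1 / (log z - s₀))` on the surface. At `z = 0` it takes its limit `p 0`. -/
noncomputable def recipLog (p : Polynomial ℂ) (s₀ : ℂ) : LogSurface → ℂ
  | none => p.eval 0
  | some s => p.eval (1 / (s - s₀))

/-- Reciprocal-log approximants `p (1 / (log z - σ n))` with `p` of degree at most `n` converge
exponentially to `f` in the supremum norm on `E`. Unless it is a constant, no approximant has its
singularity on `E`. -/
def ConvergesExponentially (E : Set LogSurface) (f : LogSurface → ℂ) (σ : ℝ) : Prop :=
  ∃ C > 0, ∃ K : ℝ, ∀ n : ℕ, ∃ p : Polynomial ℂ, p.natDegree ≤ n ∧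
    (p.natDegree = 0 ∨ some ((σ * n : ℝ) : ℂ) ∉ E) ∧
    ∀ x ∈ E, ‖f x - recipLog p ((σ * n : ℝ) : ℂ) x‖ ≤ K * Real.exp (-(C * n))

end RecipLog

/-!
In the coordinate `s = log z` the multivalued function generated by the element is, by monodromy, a
single entire function `F` (`FunctionElement.ContinuableIn.exists_entire`), and `E` lies in a
half-strip `Re s ≤ D`, `|Im s| ≤ D`. The growth hypotheses become: `F - f(0)` decays like
`exp (a Re s)` to the left, in a region whose height grows exponentially, and `F` is at most
exponential in `Re s` and polynomial in `Im s` elsewhere.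

Put `N = σ n` and represent `F - f(0)` at a point `s` of the half-strip by Cauchy's formula on a
rectangle with sides on `|Im ζ| = N`, `Re ζ = N / 2` and, far to the left, a side that depends on
`s`. The part of the contour with `Re ζ ≤ -N / 4` contributes an exponentially small amount, by the
decay of `F - f(0)`. On the remaining part, which does not depend on `s`, the kernel `1 / (ζ - s)` is
replaced by `(1 - q ^ m) / (ζ - s)` with `q = s (ζ - N)² / ((s - N)² ζ)`. This is a polynomial of
degree `2 m` in `1 / (s - N)`: it is the Hermite interpolant of the kernel with an `m`-fold node at
`s = 0` and an `(m + 1)`-fold node at `s = ∞` (`one_sub_pow_div_sub`).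

After scaling by `N`, the points `s` lie in a thin neighbourhood of `(-∞, 0]`, and `4 |t| ≤ |1 - t|²`
on that ray, while the contour is a compact subset of the region `4 |θ| > |1 - θ|²`; so `|q|` is
bounded by a constant less than `1` (`norm_ratio_le`). Its power `m = n / 2` outweighs the growth `exp (a' σ n / 2)`
of `F` on the contour once `σ` is small (`exists_polynomial_approx_halfStrip`,
`exists_exponential_approx_halfStrip`).
-/

open Filter Topology Set

namespace RecipLog

/-! ### Analytic continuation on the logarithmic plane -/

/-- In the coordinate `s = log z`, a continuation along a path that starts from an analytic function
`F` coincides with `F` for as long as the path stays in the domain of `F`. -/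
theorem IsContinuationAlong.eventuallyEq_comp_exp {s₀ s₁ : ℂ} {γ : Path s₀ s₁}
    {φ : unitInterval → ℂ → ℂ} (h : IsContinuationAlong γ φ) {F : ℂ → ℂ} {U : Set ℂ}
    (hF : AnalyticOnNhd ℂ F U) (hU : IsOpen U) {T : Set unitInterval} (hT : IsPreconnected T)
    (h0 : 0 ∈ T) (hγ : ∀ t ∈ T, γ t ∈ U) (hφ : φ 0 ∘ Complex.exp =ᶠ[𝓝 s₀] F) :
    ∀ t ∈ T, φ t ∘ Complex.exp =ᶠ[𝓝 (γ t)] F := by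
  set u : Set unitInterval := {t | φ t ∘ Complex.exp =ᶠ[𝓝 (γ t)] F} with hu
  have pull : ∀ (s : ℂ) (f g : ℂ → ℂ), f =ᶠ[𝓝 (Complex.exp s)] g →
      f ∘ Complex.exp =ᶠ[𝓝 s] g ∘ Complex.exp := fun s f g hfg =>
    hfg.comp_tendsto Complex.continuous_exp.continuousAt
  have hopen : IsOpen u := by
    rw [isOpen_iff_mem_nhds]
    intro t ht
    have h1 : ∀ᶠ v in 𝓝 t, φ t ∘ Complex.exp =ᶠ[𝓝 (γ v)] F :=
      γ.continuous.continuousAt.eventually (eventually_eventually_nhds.2 ht)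
    filter_upwards [h1, h.coherent t] with v hv1 hv2
    exact (pull _ _ _ hv2).trans hv1
  refine hT.subset_of_closure_inter_subset hopen ⟨0, h0, ?_⟩ ?_
  · change φ 0 ∘ Complex.exp =ᶠ[𝓝 (γ 0)] F
    rwa [γ.source]
  · rintro t ⟨htc, htT⟩
    have han : AnalyticAt ℂ (φ t ∘ Complex.exp) (γ t) :=
      (h.analyticAt t).comp analyticAt_cexp
    obtain ⟨r, hr, hball⟩ := Metric.eventually_nhds_iff_ball.1
      (han.eventually_analyticAt.and (hU.mem_nhds (hγ t htT)))
    have h1 : ∀ᶠ v in 𝓝 t, γ v ∈ Metric.ball (γ t) r :=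
      γ.continuous.continuousAt.eventually (Metric.ball_mem_nhds _ hr)
    obtain ⟨v, ⟨hv1, hv2⟩, hvu⟩ := mem_closure_iff_nhds.1 htc _ (h1.and (h.coherent t))
    have hEq : φ t ∘ Complex.exp =ᶠ[𝓝 (γ v)] F := (pull _ _ _ hv2).symm.trans hvu
    have := AnalyticOnNhd.eqOn_of_preconnected_of_eventuallyEq
      (fun z hz => (hball z hz).1) (fun z hz => hF z (hball z hz).2)
      (convex_ball (γ t) r).isPreconnected hv1 hEq
    exact this.eventuallyEq_of_mem (Metric.ball_mem_nhds _ hr)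

/-- An analytic function on a disc that extends analytically across each boundary point extends to a
larger disc. The local extensions agree where they meet, because two discs that are centred on a
circle and meet have a common point inside the circle. -/
theorem exists_analyticOnNhd_larger_ball {b : ℂ} {R : ℝ} (hR : 0 < R) {F : ℂ → ℂ}
    (hF : AnalyticOnNhd ℂ F (Metric.ball b R))
    (hext : ∀ ζ ∈ Metric.sphere b R, ∃ r > 0, ∃ g : ℂ → ℂ, AnalyticOnNhd ℂ g (Metric.ball ζ r) ∧
      EqOn g F (Metric.ball ζ r ∩ Metric.ball b R)) :
    ∃ R' > R, ∃ F' : ℂ → ℂ, AnalyticOnNhd ℂ F' (Metric.ball b R') ∧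
      EqOn F' F (Metric.ball b R) := by
  classical
  choose! r hr g hg hgF using hext
  have hcompat : ∀ ζ ∈ Metric.sphere b R, ∀ ξ ∈ Metric.sphere b R,
      EqOn (g ζ) (g ξ) (Metric.ball ζ (r ζ) ∩ Metric.ball ξ (r ξ)) := by
    intro ζ hζ ξ hξ x hx
    rcases eq_or_ne ζ ξ with rfl | hne
    · rfl
    have hrζ := hr ζ hζ
    have hrξ := hr ξ hξ
    have hd : dist ζ ξ < r ζ + r ξ :=
      calc dist ζ ξ ≤ dist ζ x + dist x ξ := dist_triangle _ _ _
        _ < r ζ + r ξ := add_lt_add (by rw [dist_comm]; exact hx.1) hx.2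
    -- the point that divides the chord in the ratio of the radii lies in both discs and in `ball b R`
    set y : ℂ := AffineMap.lineMap ζ ξ (r ζ / (r ζ + r ξ)) with hy
    have hs : 0 < r ζ + r ξ := by positivity
    have ht0 : 0 < r ζ / (r ζ + r ξ) := by positivity
    have ht1 : r ζ / (r ζ + r ξ) < 1 := by rw [div_lt_one hs]; linarith
    have hy1 : y ∈ Metric.ball ζ (r ζ) := by
      rw [Metric.mem_ball, hy, dist_lineMap_left, Real.norm_of_nonneg ht0.le, div_mul_eq_mul_div,
        div_lt_iff₀ hs]
      gcongr
    have hy2 : y ∈ Metric.ball ξ (r ξ) := by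
      rw [Metric.mem_ball, hy, dist_lineMap_right, Real.norm_of_nonneg (by linarith)]
      have : 1 - r ζ / (r ζ + r ξ) = r ξ / (r ζ + r ξ) := by field_simp; ring
      rw [this, div_mul_eq_mul_div, div_lt_iff₀ hs]
      gcongr
    have hy3 : y ∈ Metric.ball b R := by
      have hy' : y ∈ openSegment ℝ ζ ξ := by
        rw [openSegment_eq_image_lineMap]
        exact ⟨_, ⟨ht0, ht1⟩, rfl⟩
      have := (strictConvex_closedBall ℝ b R).openSegment_subset
        (Metric.sphere_subset_closedBall hζ) (Metric.sphere_subset_closedBall hξ) hne hy'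
      rwa [interior_closedBall _ hR.ne'] at this
    refine AnalyticOnNhd.eqOn_of_preconnected_of_eventuallyEq
      (fun z hz => hg ζ hζ z hz.1) (fun z hz => hg ξ hξ z hz.2)
      ((convex_ball ζ _).inter (convex_ball ξ _)).isPreconnected ⟨hy1, hy2⟩ ?_ hx
    filter_upwards [Metric.isOpen_ball.mem_nhds hy1, Metric.isOpen_ball.mem_nhds hy2,
      Metric.isOpen_ball.mem_nhds hy3] with z h1 h2 h3
    rw [hgF ζ hζ ⟨h1, h3⟩, hgF ξ hξ ⟨h2, h3⟩]
  set U : Set ℂ := Metric.ball b R ∪ ⋃ ζ ∈ Metric.sphere b R, Metric.ball ζ (r ζ) with hU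
  have hUo : IsOpen U :=
    Metric.isOpen_ball.union (isOpen_biUnion fun _ _ => Metric.isOpen_ball)
  have hKU : Metric.closedBall b R ⊆ U := by
    intro x hx
    rcases (Metric.mem_closedBall.1 hx).lt_or_eq with h | h
    · exact Or.inl h
    · exact Or.inr (mem_biUnion (Metric.mem_sphere.2 h) (Metric.mem_ball_self (hr x h)))
  obtain ⟨δ, hδ, hδU⟩ := (isCompact_closedBall b R).exists_thickening_subset_open hUo hKU
  rw [thickening_closedBall hδ hR.le] at hδU
  have hcov : ∀ x : ℂ, ∃ ζ, x ∈ U → x ∉ Metric.ball b R →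
      ζ ∈ Metric.sphere b R ∧ x ∈ Metric.ball ζ (r ζ) := by
    intro x
    by_cases hx : x ∈ U ∧ x ∉ Metric.ball b R
    · rcases hx.1 with h | h
      · exact absurd h hx.2
      · obtain ⟨ζ, hζ, hxζ⟩ := mem_iUnion₂.1 h
        exact ⟨ζ, fun _ _ => ⟨hζ, hxζ⟩⟩
    · exact ⟨0, fun h1 h2 => absurd ⟨h1, h2⟩ hx⟩
  choose c hc using hcov
  set F' : ℂ → ℂ := fun x => if x ∈ Metric.ball b R then F x else g (c x) x with hF'
  have hF'F : EqOn F' F (Metric.ball b R) := fun x hx => by simp only [hF', if_pos hx]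
  have hF'g : ∀ ζ ∈ Metric.sphere b R, EqOn F' (g ζ) (Metric.ball ζ (r ζ)) := by
    intro ζ hζ x hx
    by_cases hxb : x ∈ Metric.ball b R
    · rw [hF'F hxb, hgF ζ hζ ⟨hx, hxb⟩]
    · have hxU : x ∈ U := Or.inr (mem_biUnion hζ hx)
      simp only [hF', if_neg hxb]
      exact hcompat _ (hc x hxU hxb).1 _ hζ ⟨(hc x hxU hxb).2, hx⟩
  refine ⟨δ + R, by linarith, F', ?_, hF'F⟩
  intro x hx
  rcases hδU hx with h | h
  · exact (hF x h).congr (hF'F.symm.eventuallyEq_of_mem (Metric.isOpen_ball.mem_nhds h))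
  · obtain ⟨ζ, hζ, hxζ⟩ := mem_iUnion₂.1 h
    exact (hg ζ hζ x hxζ).congr
      ((hF'g ζ hζ).symm.eventuallyEq_of_mem (Metric.isOpen_ball.mem_nhds hxζ))

/-- A germ is the germ of an entire function if each of its analytic extensions to a disc can be
extended across every boundary point of the disc: its power series then has infinite radius of
convergence. -/
theorem exists_entire_of_extends_across_spheres {b : ℂ} {f : ℂ → ℂ} (hf : AnalyticAt ℂ f b)
    (hext : ∀ R > 0, ∀ F : ℂ → ℂ, AnalyticOnNhd ℂ F (Metric.ball b R) → F =ᶠ[𝓝 b] f →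
      ∀ ζ ∈ Metric.sphere b R, ∃ r > 0, ∃ g : ℂ → ℂ, AnalyticOnNhd ℂ g (Metric.ball ζ r) ∧
        EqOn g F (Metric.ball ζ r ∩ Metric.ball b R)) :
    ∃ F : ℂ → ℂ, Differentiable ℂ F ∧ F =ᶠ[𝓝 b] f := by
  obtain ⟨p, hp⟩ := hf
  obtain ⟨r₀, hr₀⟩ := hp
  have hpos : 0 < p.radius := hr₀.radius_pos
  have hsum : HasFPowerSeriesOnBall (fun z => p.sum (z - b)) p b p.radius := by
    simpa using (p.hasFPowerSeriesOnBall hpos).comp_sub b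
  have hfe : (fun z => p.sum (z - b)) =ᶠ[𝓝 b] f := by
    filter_upwards [hr₀.eventually_hasSum_sub, hsum.eventually_hasSum_sub] with z h1 h2
    exact h2.unique h1
  by_cases htop : p.radius = ⊤
  · refine ⟨_, ?_, hfe⟩
    rw [htop] at hsum
    intro z
    exact (hsum.analyticOnNhd z (by simp)).differentiableAt
  · exfalso
    have hRpos : 0 < p.radius.toReal := ENNReal.toReal_pos hpos.ne' htop
    have hball : Metric.eball b p.radius = Metric.ball b p.radius.toReal := by
      conv_lhs => rw [← ENNReal.ofReal_toReal htop]
      rw [Metric.eball_ofReal]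
    have han : AnalyticOnNhd ℂ (fun z => p.sum (z - b)) (Metric.ball b p.radius.toReal) := by
      rw [← hball]; exact hsum.analyticOnNhd
    obtain ⟨R', hR', F', hF'an, hF'eq⟩ := exists_analyticOnNhd_larger_ball hRpos han
      (hext _ hRpos _ han hfe)
    obtain ⟨R₁, hR₁, hR₁'⟩ := exists_between hR'
    have hR₁pos : 0 < R₁ := hRpos.trans hR₁
    have hF'R₁ : DifferentiableOn ℂ F' (Metric.closedBall b (R₁.toNNReal : ℝ)) := by
      rw [Real.coe_toNNReal _ hR₁pos.le]
      intro z hz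
      exact (hF'an z (Metric.closedBall_subset_ball hR₁' hz)).differentiableAt.differentiableWithinAt
    have hq := hF'R₁.hasFPowerSeriesOnBall (Real.toNNReal_pos.2 hR₁pos)
    have hev : (fun z => p.sum (z - b)) =ᶠ[𝓝 b] F' :=
      hF'eq.symm.eventuallyEq_of_mem (Metric.ball_mem_nhds _ hRpos)
    have hpq := hsum.hasFPowerSeriesAt.eq_formalMultilinearSeries_of_eventually
      hq.hasFPowerSeriesAt hev
    have hle := hq.r_le
    rw [← hpq, ← ENNReal.ofReal_toReal htop] at hle
    have : R₁ ≤ p.radius.toReal := by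
      have := (ENNReal.ofReal_le_ofReal_iff hRpos.le).1 (by simpa [ENNReal.ofReal] using hle)
      exact this
    linarith

/-- The monodromy theorem in the coordinate `s = log z`: an element that can be continued along all
curves avoiding `0` gives an entire function of `s`. -/
theorem FunctionElement.ContinuableIn.exists_entire {e : FunctionElement}
    (he : e.ContinuableIn univ) :
    ∃ F : ℂ → ℂ, Differentiable ℂ F ∧ F =ᶠ[𝓝 e.base] e.toFun ∘ Complex.exp := by
  refine exists_entire_of_extends_across_spheres
    (e.analyticAt.comp analyticAt_cexp) ?_
  intro R hR F hF hFe ζ hζ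
  let γ : Path e.base ζ :=
    { toFun := fun t => AffineMap.lineMap e.base ζ (t : ℝ)
      continuous_toFun := by
        exact (AffineMap.lineMap_continuous).comp continuous_subtype_val
      source' := by simp
      target' := by simp }
  have hγ : ∀ t, γ t = AffineMap.lineMap e.base ζ (t : ℝ) := fun t => rfl
  have hdist : ∀ t : unitInterval, t < 1 → γ t ∈ Metric.ball e.base R := by
    intro t ht
    rw [Metric.mem_ball, hγ, dist_lineMap_left, Real.norm_of_nonneg t.2.1, dist_comm,
      Metric.mem_sphere.1 hζ]
    have : (t : ℝ) < 1 := ht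
    nlinarith
  obtain ⟨φ, hφ, hφ0⟩ := he ζ γ (fun _ => mem_univ _)
  have h0 : φ 0 ∘ Complex.exp =ᶠ[𝓝 e.base] F :=
    (hφ0.comp_tendsto Complex.continuous_exp.continuousAt).trans hFe.symm
  have hprop := hφ.eventuallyEq_comp_exp hF Metric.isOpen_ball (T := Iio 1)
    (ordConnected_Iio.isPreconnected) (by simp) (fun t ht => hdist t ht) h0
  have han : AnalyticAt ℂ (φ 1 ∘ Complex.exp) ζ := by
    refine AnalyticAt.comp ?_ analyticAt_cexp
    simpa using hφ.analyticAt 1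
  obtain ⟨r, hr, hball⟩ := Metric.eventually_nhds_iff_ball.1 han.eventually_analyticAt
  refine ⟨r, hr, φ 1 ∘ Complex.exp, hball, ?_⟩
  have h1 : ∀ᶠ v in 𝓝 (1 : unitInterval), γ v ∈ Metric.ball ζ r :=
    γ.continuous.continuousAt.eventually (by rw [γ.target]; exact Metric.ball_mem_nhds ζ hr)
  have hcl : (1 : unitInterval) ∈ closure (Iio 1) := by
    rw [closure_Iio' ⟨0, by simp⟩]; simp
  obtain ⟨v, ⟨hv1, hv2⟩, hv⟩ := mem_closure_iff_nhds.1 hcl _ (h1.and (hφ.coherent 1))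
  refine AnalyticOnNhd.eqOn_of_preconnected_of_eventuallyEq
    (fun z hz => hball z hz.1) (fun z hz => hF z hz.2)
    ((convex_ball ζ _).inter (convex_ball e.base _)).isPreconnected ⟨hv1, hdist v hv⟩ ?_
  exact (hv2.comp_tendsto Complex.continuous_exp.continuousAt).symm.trans (hprop v hv)

/-- The values of all continuations of an element are those of the entire function that it
generates. -/
theorem FunctionElement.ContinuesTo.apply_exp {e : FunctionElement} {W : Set ℂ} {s : ℂ}
    {ψ : ℂ → ℂ} (h : e.ContinuesTo W s ψ) {F : ℂ → ℂ} (hF : Differentiable ℂ F)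
    (hFe : F =ᶠ[𝓝 e.base] e.toFun ∘ Complex.exp) : ψ (Complex.exp s) = F s := by
  obtain ⟨γ, -, φ, hφ, hφ0, hφ1⟩ := h
  have h0 : φ 0 ∘ Complex.exp =ᶠ[𝓝 e.base] F :=
    (hφ0.comp_tendsto Complex.continuous_exp.continuousAt).trans hFe.symm
  have := hφ.eventuallyEq_comp_exp (U := univ) (fun z _ => hF.analyticAt z) isOpen_univ
    isPreconnected_univ (mem_univ _) (fun _ _ => mem_univ _) h0 1 (mem_univ _)
  rw [γ.target] at this
  rw [← hφ1.eq_of_nhds]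
  exact this.eq_of_nhds

theorem FunctionElement.ContinuableIn.exists_continuesTo {e : FunctionElement} {W : Set ℂ}
    (he : e.ContinuableIn W) {s : ℂ} (hs : JoinedIn W e.base s) : ∃ ψ, e.ContinuesTo W s ψ := by
  obtain ⟨γ, hγ⟩ := hs
  obtain ⟨φ, hφ, hφ0⟩ := he s γ hγ
  exact ⟨φ 1, γ, hγ, φ, hφ, hφ0, EventuallyEq.rfl⟩

theorem joinedIn_wedge {r τ : ℝ} {s₀ s₁ : ℂ} (h₀ : s₀ ∈ wedge r τ) (h₁ : s₁ ∈ wedge r τ) :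
    JoinedIn (wedge r τ) s₀ s₁ := by
  have vert : ∀ s ∈ wedge r τ, JoinedIn (wedge r τ) s (s.re : ℂ) := by
    intro s hs
    refine JoinedIn.of_segment_subset ?_
    rintro _ ⟨a, b, ha, hb, hab, rfl⟩
    have hre : (a • s + b • (s.re : ℂ)).re = s.re := by
      simp only [Complex.real_smul, Complex.add_re, Complex.mul_re, Complex.ofReal_re,
        Complex.ofReal_im]
      rw [zero_mul, sub_zero, zero_mul, sub_zero, ← add_mul, hab, one_mul]
    have him : (a • s + b • (s.re : ℂ)).im = a * s.im := by simp
    simp only [wedge, mem_ofPred_eq, Complex.norm_exp] at hs ⊢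
    rw [hre, him, abs_mul, abs_of_nonneg ha]
    exact ⟨hs.1, (mul_le_of_le_one_left (abs_nonneg _) (by linarith)).trans hs.2⟩
  have horiz : JoinedIn (wedge r τ) (s₀.re : ℂ) (s₁.re : ℂ) := by
    refine JoinedIn.of_segment_subset ?_
    rintro _ ⟨a, b, ha, hb, hab, rfl⟩
    have hre : (a • (s₀.re : ℂ) + b • (s₁.re : ℂ)).re = a * s₀.re + b * s₁.re := by simp
    have him : (a • (s₀.re : ℂ) + b • (s₁.re : ℂ)).im = 0 := by simp
    simp only [wedge, mem_ofPred_eq, Complex.norm_exp] at h₀ h₁ ⊢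
    rw [hre, him, abs_zero]
    refine ⟨lt_of_le_of_lt ?_ (max_lt h₀.1 h₁.1), by positivity⟩
    rw [← Real.exp_monotone.map_max]
    refine Real.exp_le_exp.2 ?_
    calc a * s₀.re + b * s₁.re ≤ a * max s₀.re s₁.re + b * max s₀.re s₁.re := by
          gcongr
          · exact le_max_left _ _
          · exact le_max_right _ _
      _ = max s₀.re s₁.re := by rw [← add_mul, hab, one_mul]
  exact ((vert _ h₀).trans horiz).trans (vert _ h₁).symm

/-! ### Cauchy's formula on a rectangle -/

theorem integral_div_sub_eq_log_sub_log {c v s : ℂ} {a b : ℝ} (k : ℂ) (hk : k ≠ 0)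
    (h : ∀ x ∈ uIcc a b, k * (c + x * v - s) ∈ Complex.slitPlane) :
    v * ∫ x in a..b, 1 / (c + x * v - s) =
      Complex.log (k * (c + b * v - s)) - Complex.log (k * (c + a * v - s)) := by
  have hne : ∀ x ∈ uIcc a b, c + (x : ℂ) * v - s ≠ 0 := fun x hx h0 => by
    have := h x hx
    rw [h0, mul_zero] at this
    exact Complex.slitPlane_ne_zero this rfl
  rw [← intervalIntegral.integral_const_mul]
  refine intervalIntegral.integral_eq_sub_of_hasDerivAt
    (f := fun x : ℝ => Complex.log (k * (c + x * v - s))) (fun x hx => ?_) ?_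
  · have h1 : HasDerivAt (fun x : ℝ => k * (c + (x : ℂ) * v - s)) (k * v) x := by
      have := ((((Complex.ofRealCLM.hasDerivAt (x := x)).mul_const v).const_add c).sub_const
        s).const_mul k
      simpa using this
    have h2 := h1.clog_real (h x hx)
    rwa [mul_div_mul_left _ _ hk, ← mul_one_div] at h2
  · refine ContinuousOn.intervalIntegrable ?_
    refine continuousOn_const.mul (continuousOn_const.div (by fun_prop) hne)

theorem log_sub_log_neg_of_im_pos {z : ℂ} (hz : 0 < z.im) :
    Complex.log z - Complex.log (-z) = Real.pi * Complex.I := by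
  simp only [Complex.log, norm_neg, Complex.arg_neg_eq_arg_sub_pi_of_im_pos hz]
  push_cast
  ring

theorem log_sub_log_neg_of_im_neg {z : ℂ} (hz : z.im < 0) :
    Complex.log z - Complex.log (-z) = -(Real.pi * Complex.I) := by
  simp only [Complex.log, norm_neg, Complex.arg_neg_eq_arg_add_pi_of_im_neg hz]
  push_cast
  ring

theorem integral_boundary_rect_one_div_sub {z w s : ℂ} (h₁ : z.re < s.re) (h₂ : s.re < w.re)
    (h₃ : z.im < s.im) (h₄ : s.im < w.im) :
    (∫ x : ℝ in z.re..w.re, 1 / ((x + z.im * Complex.I : ℂ) - s)) -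
      (∫ x : ℝ in z.re..w.re, 1 / ((x + w.im * Complex.I : ℂ) - s)) +
      Complex.I • (∫ y : ℝ in z.im..w.im, 1 / ((w.re + y * Complex.I : ℂ) - s)) -
      Complex.I • (∫ y : ℝ in z.im..w.im, 1 / ((z.re + y * Complex.I : ℂ) - s)) =
      2 * Real.pi * Complex.I := by
  -- the principal logarithm of `ζ - s` is a primitive on three sides, that of `s - ζ` on the left one
  have hb := integral_div_sub_eq_log_sub_log (c := z.im * Complex.I) (v := 1) (s := s) (a := z.re)
    (b := w.re) 1 one_ne_zero (fun x _ => by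
      rw [Complex.mem_slitPlane_iff]; right; simp; linarith)
  have ht := integral_div_sub_eq_log_sub_log (c := w.im * Complex.I) (v := 1) (s := s) (a := z.re)
    (b := w.re) 1 one_ne_zero (fun x _ => by
      rw [Complex.mem_slitPlane_iff]; right; simp; linarith)
  have hr := integral_div_sub_eq_log_sub_log (c := w.re) (v := Complex.I) (s := s) (a := z.im)
    (b := w.im) 1 one_ne_zero (fun x _ => by
      rw [Complex.mem_slitPlane_iff]; left; simp; linarith)
  have hl := integral_div_sub_eq_log_sub_log (c := z.re) (v := Complex.I) (s := s) (a := z.im)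
    (b := w.im) (-1) (by simp) (fun x _ => by
      rw [Complex.mem_slitPlane_iff]; left; simp; linarith)
  simp only [one_mul, mul_one, neg_one_mul] at hb ht hr hl
  have e1 := log_sub_log_neg_of_im_pos (z := z.re + w.im * Complex.I - s) (by simpa using h₄)
  have e2 := log_sub_log_neg_of_im_neg (z := z.re + z.im * Complex.I - s) (by simpa using h₃)
  simp only [smul_eq_mul]
  rw [hr, hl]
  simp only [add_comm (_ : ℂ) (_ * Complex.I)] at hb ht hr hl e1 e2 ⊢
  rw [hb, ht]
  linear_combination e1 - e2

/-- Cauchy's integral formula for the boundary of a rectangle. -/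
theorem integral_boundary_rect_div_sub {F : ℂ → ℂ} (hF : Differentiable ℂ F) {z w s : ℂ}
    (h₁ : z.re < s.re) (h₂ : s.re < w.re) (h₃ : z.im < s.im) (h₄ : s.im < w.im) :
    (∫ x : ℝ in z.re..w.re, F (x + z.im * Complex.I) / ((x + z.im * Complex.I : ℂ) - s)) -
      (∫ x : ℝ in z.re..w.re, F (x + w.im * Complex.I) / ((x + w.im * Complex.I : ℂ) - s)) +
      Complex.I • (∫ y : ℝ in z.im..w.im,
        F (w.re + y * Complex.I) / ((w.re + y * Complex.I : ℂ) - s)) -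
      Complex.I • (∫ y : ℝ in z.im..w.im,
        F (z.re + y * Complex.I) / ((z.re + y * Complex.I : ℂ) - s)) =
      2 * Real.pi * Complex.I * F s := by
  have hD : Differentiable ℂ (dslope F s) := by
    rw [← differentiableOn_univ, Complex.differentiableOn_dslope univ_mem]
    exact hF.differentiableOn
  have key : ∀ (γ : ℝ → ℂ) (a b : ℝ), Continuous γ → (∀ x, γ x ≠ s) →
      ∫ x in a..b, F (γ x) / (γ x - s) =
        (∫ x in a..b, dslope F s (γ x)) + (∫ x in a..b, 1 / (γ x - s)) * F s := by
    intro γ a b hγ hne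
    rw [← intervalIntegral.integral_mul_const, ← intervalIntegral.integral_add]
    · refine intervalIntegral.integral_congr fun x _ => ?_
      have : γ x - s ≠ 0 := sub_ne_zero.2 (hne x)
      simp only [dslope_of_ne _ (hne x), slope_def_field]
      field_simp
      ring
    · exact (hD.continuous.comp hγ).intervalIntegrable _ _
    · refine Continuous.intervalIntegrable ?_ _ _
      exact (continuous_const.div (by fun_prop) fun x => sub_ne_zero.2 (hne x)).mul
        continuous_const
  have hne_im : ∀ (t : ℂ), t.im ≠ s.im → t ≠ s := fun t h h' => h (by rw [h'])
  have hne_re : ∀ (t : ℂ), t.re ≠ s.re → t ≠ s := fun t h h' => h (by rw [h'])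
  rw [key (fun x => x + z.im * Complex.I) _ _ (by fun_prop)
      (fun x => hne_im _ (by simpa using h₃.ne)),
    key (fun x => x + w.im * Complex.I) _ _ (by fun_prop)
      (fun x => hne_im _ (by simpa using h₄.ne')),
    key (fun y => w.re + y * Complex.I) _ _ (by fun_prop)
      (fun x => hne_re _ (by simpa using h₂.ne')),
    key (fun y => z.re + y * Complex.I) _ _ (by fun_prop)
      (fun x => hne_re _ (by simpa using h₁.ne))]
  have e0 := Complex.integral_boundary_rect_eq_zero_of_differentiableOn (dslope F s) z w
    hD.differentiableOn
  have e1 := integral_boundary_rect_one_div_sub h₁ h₂ h₃ h₄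
  simp only [smul_eq_mul] at e0 e1 ⊢
  linear_combination e0 + F s * e1

/-! ### Reciprocal-linear approximation of a Cauchy integral -/

/-- With `u = 1 / (s - N)` and `q = s (ζ - N)² / ((s - N)² ζ)`, the truncated kernel
`(1 - q ^ m) / (ζ - s)` is a polynomial of degree `2 m` in `u`, because `s / (s - N)² = u + N u²`
and `1 - q` has the factor `ζ - s`. -/
theorem one_sub_pow_div_sub {ζ s N : ℂ} (hζ : ζ ≠ 0) (hζN : ζ ≠ N) (hsN : s ≠ N) (hζs : ζ ≠ s)
    (m : ℕ) :
    (1 - (s * (ζ - N) ^ 2 / ((s - N) ^ 2 * ζ)) ^ m) / (ζ - s) =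
      ∑ i ∈ Finset.range m,
        (-((ζ - N) ^ 2 / ζ) ^ i * (1 / (s - N)) +
          -(N * (1 / (ζ - N)) * ((ζ - N) ^ 2 / ζ) ^ (i + 1)) * (1 / (s - N)) ^ 2) *
          (1 / (s - N) + N * (1 / (s - N)) ^ 2) ^ i := by
  have h1 : ζ - N ≠ 0 := sub_ne_zero.2 hζN
  have h2 : s - N ≠ 0 := sub_ne_zero.2 hsN
  have h3 : ζ - s ≠ 0 := sub_ne_zero.2 hζs
  have hq : s * (ζ - N) ^ 2 / ((s - N) ^ 2 * ζ) =
      ((ζ - N) ^ 2 / ζ) * (1 / (s - N) + N * (1 / (s - N)) ^ 2) := by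
    field_simp
    ring
  rw [hq]
  set w := (ζ - N) ^ 2 / ζ with hw
  set Q := 1 / (s - N) + N * (1 / (s - N)) ^ 2 with hQ
  have hlin : (1 - w * Q) / (ζ - s) =
      -(1 / (s - N) + N * (1 / (ζ - N)) * w * (1 / (s - N)) ^ 2) := by
    rw [hw, hQ]
    field_simp
    ring
  rw [← mul_neg_geom_sum (w * Q) m, mul_div_right_comm, hlin, Finset.mul_sum]
  refine Finset.sum_congr rfl fun i _ => ?_
  rw [mul_pow, pow_succ]
  ring

/-- A piece of a Cauchy integral is, up to a remainder with the factor `q ^ m`, a polynomial of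
degree at most `2 m` in `1 / (s - N)`. -/
theorem exists_polynomial_integral_div_sub {G : ℂ → ℂ} (hG : Continuous G) {γ : ℝ → ℂ}
    (hγ : Continuous γ) {a b : ℝ} {N : ℂ} (h0 : ∀ x ∈ uIcc a b, γ x ≠ 0)
    (hN : ∀ x ∈ uIcc a b, γ x ≠ N) (m : ℕ) :
    ∃ p : Polynomial ℂ, p.natDegree ≤ 2 * m ∧ p.eval 0 = 0 ∧
      ∀ s, s ≠ N → (∀ x ∈ uIcc a b, γ x ≠ s) →
        (∫ x in a..b, G (γ x) / (γ x - s)) - p.eval (1 / (s - N)) =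
          ∫ x in a..b, G (γ x) / (γ x - s) *
            (s * (γ x - N) ^ 2 / ((s - N) ^ 2 * γ x)) ^ m := by
  classical
  set A : ℕ → ℝ → ℂ := fun i x => G (γ x) * -((γ x - N) ^ 2 / γ x) ^ i with hA
  set B : ℕ → ℝ → ℂ := fun i x =>
    G (γ x) * -(N * (1 / (γ x - N)) * ((γ x - N) ^ 2 / γ x) ^ (i + 1)) with hB
  have hNsub : ∀ x ∈ uIcc a b, γ x - N ≠ 0 := fun x hx => sub_ne_zero.2 (hN x hx)
  have hw : ContinuousOn (fun x => (γ x - N) ^ 2 / γ x) (uIcc a b) :=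
    ContinuousOn.div (by fun_prop) hγ.continuousOn h0
  have hv : ContinuousOn (fun x => 1 / (γ x - N)) (uIcc a b) :=
    ContinuousOn.div (by fun_prop) (by fun_prop) hNsub
  have hGγ : ContinuousOn (fun x => G (γ x)) (uIcc a b) := (hG.comp hγ).continuousOn
  have hAi : ∀ i, IntervalIntegrable (A i) MeasureTheory.volume a b := fun i =>
    (hGγ.mul (hw.pow i).neg).intervalIntegrable
  have hBi : ∀ i, IntervalIntegrable (B i) MeasureTheory.volume a b := fun i =>
    (hGγ.mul ((continuousOn_const.mul hv).mul (hw.pow (i + 1))).neg).intervalIntegrable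
  refine ⟨∑ i ∈ Finset.range m,
    (Polynomial.C (∫ x in a..b, A i x) * Polynomial.X +
      Polynomial.C (∫ x in a..b, B i x) * Polynomial.X ^ 2) *
      (Polynomial.X + Polynomial.C N * Polynomial.X ^ 2) ^ i, ?_, ?_, ?_⟩
  · refine Polynomial.natDegree_sum_le_of_forall_le _ _ fun i hi => ?_
    have hi' : i + 1 ≤ m := Finset.mem_range.1 hi
    have hquad : ∀ α β : ℂ, (Polynomial.C α * Polynomial.X +
        Polynomial.C β * Polynomial.X ^ 2).natDegree ≤ 2 := fun α β => by compute_degree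
    have h1 := hquad (∫ x in a..b, A i x) (∫ x in a..b, B i x)
    have h2 : (Polynomial.X + Polynomial.C N * Polynomial.X ^ 2).natDegree ≤ 2 := by
      compute_degree
    calc _ ≤ 2 + i * 2 := Polynomial.natDegree_mul_le_of_le h1
            (Polynomial.natDegree_pow_le_of_le i h2)
      _ ≤ 2 * m := by omega
  · rw [Polynomial.eval_finsetSum]
    refine Finset.sum_eq_zero fun i _ => ?_
    simp
  · intro s hsN hs
    have hssub : ∀ x ∈ uIcc a b, γ x - s ≠ 0 := fun x hx => sub_ne_zero.2 (hs x hx)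
    have hker : ContinuousOn (fun x => G (γ x) / (γ x - s)) (uIcc a b) :=
      hGγ.div (by fun_prop) hssub
    have hq : ContinuousOn (fun x => (s * (γ x - N) ^ 2 / ((s - N) ^ 2 * γ x)) ^ m)
        (uIcc a b) := by
      refine ContinuousOn.pow (ContinuousOn.div (by fun_prop) (by fun_prop) fun x hx => ?_) m
      exact mul_ne_zero (pow_ne_zero 2 (sub_ne_zero.2 hsN)) (h0 x hx)
    have hkq : ContinuousOn (fun x => G (γ x) / (γ x - s) *
        (s * (γ x - N) ^ 2 / ((s - N) ^ 2 * γ x)) ^ m) (uIcc a b) := hker.mul hq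
    rw [sub_eq_iff_eq_add, ← sub_eq_iff_eq_add',
      ← intervalIntegral.integral_sub hker.intervalIntegrable hkq.intervalIntegrable]
    simp only [Polynomial.eval_finsetSum, Polynomial.eval_mul, Polynomial.eval_add,
      Polynomial.eval_pow, Polynomial.eval_C, Polynomial.eval_X]
    set u := 1 / (s - N) with hu
    have hint : ∀ i, ((∫ x in a..b, A i x) * u + (∫ x in a..b, B i x) * u ^ 2) *
        (u + N * u ^ 2) ^ i =
        ∫ x in a..b, (A i x * u + B i x * u ^ 2) * (u + N * u ^ 2) ^ i := by
      intro i
      rw [intervalIntegral.integral_mul_const, intervalIntegral.integral_add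
        ((hAi i).mul_const _) ((hBi i).mul_const _), intervalIntegral.integral_mul_const,
        intervalIntegral.integral_mul_const]
    simp only [hint]
    rw [← intervalIntegral.integral_finsetSum fun i _ =>
      (((hAi i).mul_const _).add ((hBi i).mul_const _)).mul_const _]
    refine intervalIntegral.integral_congr fun x hx => ?_
    have := one_sub_pow_div_sub (h0 x hx) (hN x hx) hsN (hs x hx) m
    have h3 : G (γ x) / (γ x - s) - G (γ x) / (γ x - s) *
        (s * (γ x - N) ^ 2 / ((s - N) ^ 2 * γ x)) ^ m =
        G (γ x) * ((1 - (s * (γ x - N) ^ 2 / ((s - N) ^ 2 * γ x)) ^ m) / (γ x - s)) := by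
      ring
    simp only [h3, this, Finset.mul_sum, hA, hB]
    refine Finset.sum_congr rfl fun i _ => ?_
    ring

/-! ### The scaled contour -/

theorem norm_le_norm_sub_sq_of_halfStrip {s : ℂ} {D N : ℝ} (hDN : 16 * D ≤ N) (hre : s.re ≤ D)
    (him : |s.im| ≤ D) : 16 * N * ‖s‖ ≤ 5 * ‖s - N‖ ^ 2 := by
  have hD : 0 ≤ D := (abs_nonneg _).trans him
  have h1 : ‖s‖ ≤ |s.re| + N / 16 := (Complex.norm_le_abs_re_add_abs_im s).trans (by linarith)
  have h2 : (N - s.re) ^ 2 ≤ ‖s - N‖ ^ 2 := by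
    rw [Complex.sq_norm, Complex.normSq_apply]
    simp only [Complex.sub_re, Complex.ofReal_re]
    nlinarith [mul_self_nonneg (s - N).im]
  have h3 : 16 * N * ‖s‖ ≤ 16 * N * (|s.re| + N / 16) := by gcongr; linarith
  rcases le_total s.re 0 with h | h
  · rw [abs_of_nonpos h] at h3
    nlinarith [sq_nonneg (N + s.re), sq_nonneg (N - s.re), sq_nonneg s.re, sq_nonneg N]
  · rw [abs_of_nonneg h] at h3
    nlinarith

theorem norm_sub_sq_le_of_abs_im_eq {ζ : ℂ} {N : ℝ} (hN : 0 ≤ N) (h1 : -(N / 4) ≤ ζ.re)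
    (h2 : ζ.re ≤ N / 2) (h3 : |ζ.im| = N) : 16 * ‖ζ - N‖ ^ 2 ≤ 41 * N * ‖ζ‖ := by
  have hζ : N ≤ ‖ζ‖ := h3 ▸ Complex.abs_im_le_norm ζ
  have h4 : ‖ζ - N‖ ^ 2 = (N - ζ.re) ^ 2 + N ^ 2 := by
    rw [Complex.sq_norm, Complex.normSq_apply]
    simp only [Complex.sub_re, Complex.ofReal_re, Complex.sub_im, Complex.ofReal_im, sub_zero]
    rw [← h3, sq_abs]
    ring
  nlinarith

theorem norm_sub_sq_le_of_re_eq {ζ : ℂ} {N : ℝ} (h2 : ζ.re = N / 2)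
    (h3 : |ζ.im| ≤ N) : 16 * ‖ζ - N‖ ^ 2 ≤ 41 * N * ‖ζ‖ := by
  have hN : 0 ≤ N := (abs_nonneg _).trans h3
  have hζ : ‖ζ‖ ≤ 3 / 2 * N := by
    refine (Complex.norm_le_abs_re_add_abs_im ζ).trans ?_
    rw [h2, abs_of_nonneg (by linarith)]
    linarith
  have h4 : ‖ζ - N‖ ^ 2 = ‖ζ‖ ^ 2 := by
    simp only [Complex.sq_norm, Complex.normSq_apply, Complex.sub_re, Complex.ofReal_re,
      Complex.sub_im, Complex.ofReal_im, h2]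
    ring
  rw [h4]
  nlinarith [norm_nonneg ζ]

theorem norm_ratio_le {ζ s : ℂ} {N : ℝ} (hN : 0 < N) (hζ : ζ ≠ 0) (hs : s ≠ N)
    (h1 : 16 * N * ‖s‖ ≤ 5 * ‖s - N‖ ^ 2) (h2 : 16 * ‖ζ - N‖ ^ 2 ≤ 41 * N * ‖ζ‖) :
    ‖s * (ζ - N) ^ 2 / ((s - N) ^ 2 * ζ)‖ ≤ 205 / 256 := by
  have h3 : 0 < ‖s - N‖ := norm_pos_iff.2 (sub_ne_zero.2 hs)
  have h4 : 0 < ‖ζ‖ := norm_pos_iff.2 hζ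
  rw [norm_div, norm_mul, norm_mul, norm_pow, norm_pow, div_le_iff₀ (by positivity)]
  have h5 : (16 * N * ‖s‖) * (16 * ‖ζ - N‖ ^ 2) ≤ (5 * ‖s - N‖ ^ 2) * (41 * N * ‖ζ‖) :=
    mul_le_mul h1 h2 (by positivity) (by positivity)
  have h6 : N * (256 * (‖s‖ * ‖ζ - N‖ ^ 2)) ≤ N * (205 * (‖s - N‖ ^ 2 * ‖ζ‖)) := by
    linarith
  have := le_of_mul_le_mul_left h6 hN
  linarith

theorem norm_integral_le_of_exp_decay {H : ℝ → ℂ} {A a X Y : ℝ} (hA : 0 ≤ A) (ha : 0 < a)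
    (hXY : X ≤ Y) (hH : ∀ x ∈ Icc X Y, ‖H x‖ ≤ A * Real.exp (a * x)) :
    ‖∫ x in X..Y, H x‖ ≤ A / a * Real.exp (a * Y) := by
  have h1 : ‖∫ x in X..Y, H x‖ ≤ ∫ x in X..Y, A * Real.exp (a * x) := by
    refine intervalIntegral.norm_integral_le_of_norm_le hXY ?_ ?_
    · exact Eventually.of_forall fun x hx => hH x (Ioc_subset_Icc_self hx)
    · exact (by fun_prop : Continuous fun x : ℝ => A * Real.exp (a * x)).intervalIntegrable _ _
  have h2 : ∫ x in X..Y, A * Real.exp (a * x) =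
      A / a * Real.exp (a * Y) - A / a * Real.exp (a * X) := by
    refine intervalIntegral.integral_eq_sub_of_hasDerivAt
      (f := fun x => A / a * Real.exp (a * x)) (fun x _ => ?_) ?_
    · refine (((hasDerivAt_id' x).const_mul a).exp.const_mul (A / a)).congr_deriv ?_
      field_simp
    · exact (by fun_prop : Continuous fun x : ℝ => A * Real.exp (a * x)).intervalIntegrable _ _
  have : 0 ≤ A / a * Real.exp (a * X) := by positivity
  linarith

/-- The approximation step. Cauchy's formula is used on the rectangle with sides on `|Im ζ| = N`,
`Re ζ = N / 2` and far to the left. On the part with `Re ζ ≥ -N / 4` the Cauchy kernel is replaced by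
the truncated kernel, a polynomial in `1 / (s - N)`; on the rest of the contour `G` is small. -/
theorem exists_polynomial_approx_halfStrip {G : ℂ → ℂ} (hG : Differentiable ℂ G)
    {A a M D N : ℝ} (hA : 0 ≤ A) (ha : 0 < a) (hN : 4 ≤ N) (hDN : 16 * D ≤ N)
    (hL : ∀ ζ : ℂ, ζ.re ≤ -(N / 4) → |ζ.im| ≤ N → ‖G ζ‖ ≤ A * Real.exp (a * ζ.re))
    (hM : ∀ ζ : ℂ, -(N / 4) ≤ ζ.re → ζ.re ≤ N / 2 → |ζ.im| ≤ N → ‖G ζ‖ ≤ M) (m : ℕ) :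
    ∃ p : Polynomial ℂ, p.natDegree ≤ 2 * m ∧ p.eval 0 = 0 ∧
      ∀ s : ℂ, s.re ≤ D → |s.im| ≤ D →
        ‖G s - p.eval (1 / (s - N))‖ ≤
          A * (2 / a + 2 * N) * Real.exp (-(a * (N / 4))) + 4 * N * M * (205 / 256) ^ m := by
  have hNabs : |N| = N := abs_of_nonneg (by linarith)
  have hM0 : 0 ≤ M := (norm_nonneg _).trans (hM 0 (by simp; linarith) (by simp; linarith)
    (by simp; linarith))
  have horiz : ∀ y : ℝ, |y| = N → ∀ x ∈ uIcc (-(N / 4)) (N / 2),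
      (x + y * Complex.I : ℂ) ≠ 0 ∧ (x + y * Complex.I : ℂ) ≠ (N : ℂ) := by
    intro y hy x _
    have hy0 : y ≠ 0 := fun h => by rw [h, abs_zero] at hy; linarith
    constructor <;>
    · intro h
      have := congrArg Complex.im h
      simp at this
      exact hy0 this
  have hNI : |(-N)| = N := by rw [abs_neg, hNabs]
  obtain ⟨p₁, hp₁, hp₁0, hp₁s⟩ := exists_polynomial_integral_div_sub hG.continuous
    (γ := fun x : ℝ => x + ((-N : ℝ) : ℂ) * Complex.I) (by fun_prop) (N := N)
    (fun x hx => (horiz (-N) hNI x hx).1) (fun x hx => (horiz (-N) hNI x hx).2) m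
  obtain ⟨p₂, hp₂, hp₂0, hp₂s⟩ := exists_polynomial_integral_div_sub hG.continuous
    (γ := fun x : ℝ => x + (N : ℂ) * Complex.I) (by fun_prop) (N := N)
    (fun x hx => (horiz N hNabs x hx).1) (fun x hx => (horiz N hNabs x hx).2) m
  have hvert : ∀ (t : ℂ), t.re ≠ N / 2 → ∀ y : ℝ, ((N / 2 : ℝ) : ℂ) + y * Complex.I ≠ t := by
    intro t ht y h
    apply ht
    rw [← h]
    simp
  obtain ⟨p₃, hp₃, hp₃0, hp₃s⟩ := exists_polynomial_integral_div_sub hG.continuous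
    (γ := fun y : ℝ => ((N / 2 : ℝ) : ℂ) + y * Complex.I) (by fun_prop) (N := N) (a := -N) (b := N)
    (fun y _ => hvert 0 (by simp; linarith) y) (fun y _ => hvert N (by simp; linarith) y) m
  refine ⟨Polynomial.C (1 / (2 * Real.pi * Complex.I)) * (p₁ - p₂ + Polynomial.C Complex.I * p₃),
    ?_, ?_, ?_⟩
  · refine (Polynomial.natDegree_C_mul_le _ _).trans ?_
    refine Polynomial.natDegree_add_le_of_degree_le ?_
      ((Polynomial.natDegree_C_mul_le _ _).trans hp₃)
    exact (Polynomial.natDegree_sub_le_iff_left hp₂).2 hp₁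
  · simp [hp₁0, hp₂0, hp₃0]
  intro s hre him
  have hD : 0 ≤ D := (abs_nonneg _).trans him
  have hsN : s ≠ N := by
    intro h
    have := congrArg Complex.re h
    simp at this
    linarith
  have hs16 := norm_le_norm_sub_sq_of_halfStrip hDN hre him
  set X : ℝ := N + |s.re| with hX
  have hXs : N ≤ X + s.re := by linarith [neg_abs_le s.re]
  have hXN : N ≤ X := by linarith [abs_nonneg s.re]
  have him' := abs_le.1 him
  -- distance from `s` to the contour
  have dist_horiz : ∀ x y : ℝ, |y| = N → 1 ≤ ‖(x + y * Complex.I : ℂ) - s‖ := by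
    intro x y hy
    refine le_trans ?_ (Complex.abs_im_le_norm _)
    have : ((x + y * Complex.I : ℂ) - s).im = y - s.im := by simp
    rw [this]
    have := abs_sub_abs_le_abs_sub y s.im
    rw [hy] at this
    linarith
  have dist_right : ∀ y : ℝ, 1 ≤ ‖(((N / 2 : ℝ) : ℂ) + y * Complex.I) - s‖ := by
    intro y
    refine le_trans ?_ (Complex.abs_re_le_norm _)
    have : ((((N / 2 : ℝ) : ℂ) + y * Complex.I) - s).re = N / 2 - s.re := by simp
    rw [this]
    exact le_trans (by linarith) (le_abs_self _)
  have dist_left : ∀ y : ℝ, 1 ≤ ‖(((-X : ℝ) : ℂ) + y * Complex.I) - s‖ := by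
    intro y
    refine le_trans ?_ (Complex.abs_re_le_norm _)
    have : ((((-X : ℝ) : ℂ) + y * Complex.I) - s).re = -X - s.re := by simp
    rw [this]
    exact le_trans (by linarith) (neg_le_abs _)
  have ne_of_dist : ∀ ζ : ℂ, 1 ≤ ‖ζ - s‖ → ζ ≠ s := by
    rintro ζ h rfl
    simp at h
    linarith
  have div_le : ∀ (ζ : ℂ) (B : ℝ), 1 ≤ ‖ζ - s‖ → ‖G ζ‖ ≤ B → ‖G ζ / (ζ - s)‖ ≤ B := by
    intro ζ B h1 h2
    rw [norm_div]
    exact (div_le_self (norm_nonneg _) h1).trans h2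
  have cauchy := integral_boundary_rect_div_sub hG (z := ⟨-X, -N⟩) (w := ⟨N / 2, N⟩) (s := s)
    (by simp; linarith) (by simp; linarith) (by simp; linarith) (by simp; linarith)
  simp only [smul_eq_mul] at cauchy
  have split : ∀ y : ℝ, |y| = N →
      (∫ x : ℝ in (-X)..(N / 2), G (x + y * Complex.I) / ((x + y * Complex.I : ℂ) - s)) =
      (∫ x : ℝ in (-X)..(-(N / 4)), G (x + y * Complex.I) / ((x + y * Complex.I : ℂ) - s)) +
      ∫ x : ℝ in (-(N / 4))..(N / 2), G (x + y * Complex.I) / ((x + y * Complex.I : ℂ) - s) := by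
    intro y hy
    have hc : Continuous fun x : ℝ => G (x + y * Complex.I) / ((x + y * Complex.I : ℂ) - s) :=
      (hG.continuous.comp (by fun_prop)).div (by fun_prop)
        fun x => sub_ne_zero.2 (ne_of_dist _ (dist_horiz x y hy))
    exact (intervalIntegral.integral_add_adjacent_intervals (hc.intervalIntegrable _ _)
      (hc.intervalIntegrable _ _)).symm
  rw [split _ hNI, split _ hNabs] at cauchy
  -- the part of the contour where `G` is small
  have tail : ∀ y : ℝ, |y| = N →
      ‖∫ x : ℝ in (-X)..(-(N / 4)), G (x + y * Complex.I) / ((x + y * Complex.I : ℂ) - s)‖ ≤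
        A / a * Real.exp (-(a * (N / 4))) := by
    intro y hy
    have := norm_integral_le_of_exp_decay (X := -X) (Y := -(N / 4)) hA ha (by linarith)
      (H := fun x : ℝ => G (x + y * Complex.I) / ((x + y * Complex.I : ℂ) - s)) (by
        intro x hx
        refine div_le _ _ (dist_horiz x y hy) ?_
        simpa using hL (x + y * Complex.I) (by simpa using hx.2) (by simp [hy]))
    rwa [mul_neg] at this
  have left : ‖∫ y : ℝ in (-N)..N, G (((-X : ℝ) : ℂ) + y * Complex.I) /
      ((((-X : ℝ) : ℂ) + y * Complex.I) - s)‖ ≤ A * Real.exp (-(a * (N / 4))) * (2 * N) := by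
    have := intervalIntegral.norm_integral_le_of_norm_le_const (a := -N) (b := N)
      (f := fun y : ℝ => G (((-X : ℝ) : ℂ) + y * Complex.I) /
        ((((-X : ℝ) : ℂ) + y * Complex.I) - s)) (C := A * Real.exp (-(a * (N / 4)))) (by
        intro y hy
        rw [uIoc_of_le (by linarith)] at hy
        refine div_le _ _ (dist_left y) ?_
        refine (hL _ (by simp; linarith) (by simpa using abs_le.2 ⟨hy.1.le, hy.2⟩)).trans ?_
        gcongr
        simp
        nlinarith)
    rwa [show N - -N = 2 * N by ring, abs_of_nonneg (by linarith : 0 ≤ 2 * N)] at this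
  -- the part of the contour where the kernel is replaced
  have rem_horiz : ∀ y : ℝ, |y| = N →
      ‖∫ x : ℝ in (-(N / 4))..(N / 2), G (x + y * Complex.I) / ((x + y * Complex.I : ℂ) - s) *
        (s * ((x + y * Complex.I : ℂ) - N) ^ 2 /
          ((s - N) ^ 2 * (x + y * Complex.I : ℂ))) ^ m‖ ≤ M * (205 / 256) ^ m * N := by
    intro y hy
    refine (intervalIntegral.norm_integral_le_of_norm_le_const
      (C := M * (205 / 256) ^ m) fun x hx => ?_).trans ?_
    · have hx' := uIoc_subset_uIcc hx
      rw [uIoc_of_le (by linarith)] at hx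
      rw [norm_mul, norm_pow]
      refine mul_le_mul (div_le _ _ (dist_horiz x y hy)
        (hM _ (by simpa using hx.1.le) (by simpa using hx.2) (by simp [hy])))
        (pow_le_pow_left₀ (norm_nonneg _) ?_ m) (by positivity) hM0
      exact norm_ratio_le (by linarith) (horiz y hy x hx').1 hsN hs16
        (norm_sub_sq_le_of_abs_im_eq (by linarith) (by simpa using hx.1.le) (by simpa using hx.2)
          (by simp [hy]))
    · rw [show N / 2 - -(N / 4) = 3 / 4 * N by ring, abs_of_nonneg (by linarith)]
      gcongr
      linarith
  have rem_right :
      ‖∫ y : ℝ in (-N)..N, G (((N / 2 : ℝ) : ℂ) + y * Complex.I) /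
        ((((N / 2 : ℝ) : ℂ) + y * Complex.I) - s) *
        (s * ((((N / 2 : ℝ) : ℂ) + y * Complex.I) - N) ^ 2 /
          ((s - N) ^ 2 * (((N / 2 : ℝ) : ℂ) + y * Complex.I))) ^ m‖ ≤
        M * (205 / 256) ^ m * (2 * N) := by
    refine (intervalIntegral.norm_integral_le_of_norm_le_const
      (C := M * (205 / 256) ^ m) fun y hy => ?_).trans ?_
    · rw [uIoc_of_le (by linarith)] at hy
      have hy' : |y| ≤ N := abs_le.2 ⟨hy.1.le, hy.2⟩
      rw [norm_mul, norm_pow]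
      refine mul_le_mul (div_le _ _ (dist_right y)
        (hM _ (by simp; linarith) (by simp) (by simpa using hy')))
        (pow_le_pow_left₀ (norm_nonneg _) ?_ m) (by positivity) hM0
      exact norm_ratio_le (by linarith) (hvert 0 (by simp; linarith) y) hsN hs16
        (norm_sub_sq_le_of_re_eq (by simp) (by simpa using hy'))
    · rw [show N - -N = 2 * N by ring, abs_of_nonneg (by linarith : 0 ≤ 2 * N)]
  have e₁ := hp₁s s hsN (fun x _ => ne_of_dist _ (dist_horiz x _ hNI))
  have e₂ := hp₂s s hsN (fun x _ => ne_of_dist _ (dist_horiz x _ hNabs))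
  have e₃ := hp₃s s hsN (fun y _ => ne_of_dist _ (dist_right y))
  have t₁ := tail _ hNI
  have t₂ := tail _ hNabs
  have r₁ := rem_horiz _ hNI
  have r₂ := rem_horiz _ hNabs
  rw [← e₁] at r₁
  rw [← e₂] at r₂
  rw [← e₃] at rem_right
  set T₁ := ∫ x : ℝ in (-X)..(-(N / 4)), G (x + ((-N : ℝ) : ℂ) * Complex.I) /
    ((x + ((-N : ℝ) : ℂ) * Complex.I : ℂ) - s)
  set T₂ := ∫ x : ℝ in (-X)..(-(N / 4)), G (x + (N : ℂ) * Complex.I) /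
    ((x + (N : ℂ) * Complex.I : ℂ) - s)
  set V := ∫ y : ℝ in (-N)..N, G (((-X : ℝ) : ℂ) + y * Complex.I) /
      ((((-X : ℝ) : ℂ) + y * Complex.I) - s)
  set J₁ := ∫ x : ℝ in (-(N / 4))..(N / 2), G (x + ((-N : ℝ) : ℂ) * Complex.I) /
    ((x + ((-N : ℝ) : ℂ) * Complex.I : ℂ) - s)
  set J₂ := ∫ x : ℝ in (-(N / 4))..(N / 2), G (x + (N : ℂ) * Complex.I) /
    ((x + (N : ℂ) * Complex.I : ℂ) - s)
  set J₃ := ∫ y : ℝ in (-N)..N, G (((N / 2 : ℝ) : ℂ) + y * Complex.I) /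
    ((((N / 2 : ℝ) : ℂ) + y * Complex.I) - s)
  set P₁ := p₁.eval (1 / (s - N))
  set P₂ := p₂.eval (1 / (s - N))
  set P₃ := p₃.eval (1 / (s - N))
  have hpi : (2 * Real.pi * Complex.I : ℂ) ≠ 0 := by simp [Real.pi_ne_zero]
  have main : (2 * Real.pi * Complex.I) * (G s - (Polynomial.C (1 / (2 * Real.pi * Complex.I)) *
      (p₁ - p₂ + Polynomial.C Complex.I * p₃)).eval (1 / (s - N))) =
      T₁ - T₂ - Complex.I * V + (J₁ - P₁) - (J₂ - P₂) + Complex.I * (J₃ - P₃) := by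
    simp only [Polynomial.eval_mul, Polynomial.eval_add, Polynomial.eval_sub, Polynomial.eval_C]
    rw [mul_sub, ← cauchy, ← mul_assoc, mul_one_div_cancel hpi]
    ring
  have hnorm : ‖(2 * Real.pi * Complex.I : ℂ)‖ = 2 * Real.pi := by
    simp [abs_of_pos Real.pi_pos]
  have hle : ∀ x : ℂ, ‖x‖ ≤ ‖(2 * Real.pi * Complex.I) * x‖ := by
    intro x
    rw [norm_mul, hnorm]
    have := Real.pi_gt_three
    exact le_mul_of_one_le_left (norm_nonneg _) (by linarith)
  refine (hle _).trans ?_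
  rw [main]
  have b1 : ‖Complex.I * V‖ = ‖V‖ := by simp
  have b2 : ‖Complex.I * (J₃ - P₃)‖ = ‖J₃ - P₃‖ := by simp
  calc _ ≤ ‖T₁‖ + ‖T₂‖ + ‖V‖ + ‖J₁ - P₁‖ + ‖J₂ - P₂‖ + ‖J₃ - P₃‖ := by
        rw [← b1, ← b2]
        refine (norm_add_le _ _).trans (add_le_add ?_ le_rfl)
        refine (norm_sub_le _ _).trans (add_le_add ?_ le_rfl)
        refine (norm_add_le _ _).trans (add_le_add ?_ le_rfl)
        refine (norm_sub_le _ _).trans (add_le_add ?_ le_rfl)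
        exact norm_sub_le _ _
    _ ≤ A / a * Real.exp (-(a * (N / 4))) + A / a * Real.exp (-(a * (N / 4))) +
        A * Real.exp (-(a * (N / 4))) * (2 * N) + M * (205 / 256) ^ m * N +
        M * (205 / 256) ^ m * N + M * (205 / 256) ^ m * (2 * N) := by gcongr
    _ = _ := by ring

/-! ### Exponential convergence -/

theorem isLittleO_rpow_mul_linear_exp (u v q x y : ℝ) {β : ℝ} (hβ : 0 < β) :
    (fun N : ℝ => (u + v * N ^ q) * (x + y * N)) =o[atTop] fun N => Real.exp (β * N) := by
  have hconst : ∀ k : ℝ, (fun _ : ℝ => k) =o[atTop] fun N => Real.exp (β / 2 * N) := fun k => by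
    simpa using (isLittleO_rpow_exp_pos_mul_atTop 0 (half_pos hβ)).const_mul_left k
  have h1 : (fun N : ℝ => u + v * N ^ q) =o[atTop] fun N => Real.exp (β / 2 * N) :=
    (hconst u).add ((isLittleO_rpow_exp_pos_mul_atTop q (half_pos hβ)).const_mul_left v)
  have h2 : (fun N : ℝ => x + y * N) =o[atTop] fun N => Real.exp (β / 2 * N) := by
    refine (hconst x).add (Asymptotics.IsLittleO.const_mul_left ?_ y)
    simpa using isLittleO_rpow_exp_pos_mul_atTop 1 (half_pos hβ)
  refine (h1.mul h2).congr_right fun N => ?_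
  rw [← Real.exp_add]
  congr 1
  ring

theorem pow_half_le_exp (n : ℕ) :
    (205 / 256 : ℝ) ^ (n / 2) ≤
      Real.exp (Real.log (256 / 205)) * Real.exp (-(Real.log (256 / 205) / 2 * n)) := by
  have hlog : 0 < Real.log (256 / 205) := Real.log_pos (by norm_num)
  have h1 : (205 / 256 : ℝ) = Real.exp (-Real.log (256 / 205)) := by
    rw [Real.exp_neg, Real.exp_log (by norm_num)]
    norm_num
  have h2 : (n : ℝ) ≤ 2 * ((n / 2 : ℕ) : ℝ) + 1 := by
    have : n ≤ 2 * (n / 2) + 1 := by omega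
    exact_mod_cast this
  rw [h1, ← Real.exp_nat_mul, ← Real.exp_add, Real.exp_le_exp]
  nlinarith

/-- Exponential convergence on a half-strip, in the coordinate `s = log z`. With `N = σ n` the growth
bound on the contour costs a factor `exp (a' N / 2)`, and the truncated kernel of degree `n` gains
`(205 / 256) ^ (n / 2)`; the gain dominates exactly when `a' σ < log (256 / 205)`. -/
theorem exists_exponential_approx_halfStrip {F : ℂ → ℂ} (hF : Differentiable ℂ F) {f₀ : ℂ}
    {r τ a b c a' b' c' D : ℝ} (hr : 0 < r) (hτ : 0 < τ) (ha : 0 < a) (hb : 0 < b) (hc : 0 < c)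
    (ha' : 0 < a') (hb' : 0 < b') (hc' : 0 < c') (hD : 0 ≤ D)
    (hnear : ∀ s : ℂ, Real.exp s.re < r → |s.im| ≤ Real.exp (-(τ * s.re)) →
      ‖F s - f₀‖ ≤ c * Real.exp (a * s.re) * (1 + |s.im| ^ b))
    (hglob : ∀ s : ℂ, ‖F s‖ ≤ c' * (1 + Real.exp (a' * s.re)) * (1 + |s.im| ^ b')) :
    ∃ σ₀ > 0, ∀ σ : ℝ, 0 < σ → σ < σ₀ → ∃ C > 0, ∃ K : ℝ, ∀ n : ℕ, ∃ p : Polynomial ℂ,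
      p.natDegree ≤ n ∧ (p.natDegree = 0 ∨ D < σ * n) ∧
      ‖f₀ - p.eval 0‖ ≤ K * Real.exp (-(C * n)) ∧
      ∀ s : ℂ, s.re ≤ D → |s.im| ≤ D →
        ‖F s - p.eval (1 / (s - ((σ * n : ℝ) : ℂ)))‖ ≤ K * Real.exp (-(C * n)) := by
  set l := Real.log (256 / 205) with hl
  have hlpos : 0 < l := Real.log_pos (by norm_num)
  refine ⟨l / a', by positivity, fun σ hσ hσ₀ => ?_⟩
  set κ := l / (2 * σ) - a' / 2 with hκ
  have hκpos : 0 < κ := by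
    have h1 : σ * a' < l := (lt_div_iff₀ ha').1 hσ₀
    have : κ = (l - σ * a') / (2 * σ) := by
      rw [hκ]
      field_simp
    rw [this]
    exact div_pos (by linarith) (by positivity)
  set μ := min (a / 8) (κ / 2) with hμ
  have hμpos : 0 < μ := lt_min (by positivity) (by positivity)
  -- all conditions on `N = σ n` hold eventually
  have ev1 := (isLittleO_rpow_mul_linear_exp c c b (2 / a) 2
    (β := a / 8) (by positivity)).bound (c := 1 / 2) (by norm_num)
  have ev2 := (isLittleO_rpow_mul_linear_exp (2 * c' + ‖f₀‖) (2 * c') b' 0 (4 * Real.exp l)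
    (β := κ / 2) (by positivity)).bound (c := 1 / 2) (by norm_num)
  have ev3 : ∀ᶠ N : ℝ in atTop, N ≤ Real.exp (τ * (N / 4)) := by
    have := (isLittleO_rpow_exp_pos_mul_atTop 1 (b := τ / 4) (by positivity)).bound
      (c := 1) one_pos
    filter_upwards [this] with N hN
    simp only [Real.rpow_one, Real.norm_eq_abs, Real.abs_exp, one_mul] at hN
    calc N ≤ |N| := le_abs_self N
      _ ≤ Real.exp (τ / 4 * N) := hN
      _ = _ := by ring_nf
  have ev4 : ∀ᶠ N : ℝ in atTop, Real.exp (-(N / 4)) < r := by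
    have : Tendsto (fun N : ℝ => Real.exp (-(N / 4))) atTop (𝓝 0) :=
      Real.tendsto_exp_neg_atTop_nhds_zero.comp (tendsto_id.atTop_div_const (by norm_num))
    exact this.eventually (gt_mem_nhds hr)
  have hlim : Tendsto (fun n : ℕ => σ * (n : ℝ)) atTop atTop :=
    tendsto_natCast_atTop_atTop.const_mul_atTop hσ
  obtain ⟨n₀, hn₀⟩ := eventually_atTop.1 (hlim.eventually (ev1.and (ev2.and (ev3.and
    (ev4.and ((eventually_ge_atTop 4).and (eventually_ge_atTop (16 * D))))))))
  set B := c' * (1 + Real.exp (a' * D)) * (1 + D ^ b') + ‖f₀‖ with hB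
  have hBpos : 0 ≤ B := by positivity
  refine ⟨μ * σ, by positivity, 1 + B * Real.exp (μ * σ * n₀), fun n => ?_⟩
  have hK1 : 1 ≤ 1 + B * Real.exp (μ * σ * n₀) := by
    have : 0 ≤ B * Real.exp (μ * σ * n₀) := by positivity
    linarith
  have hrhs : 0 ≤ (1 + B * Real.exp (μ * σ * n₀)) * Real.exp (-(μ * σ * n)) :=
    mul_nonneg (zero_le_one.trans hK1) (Real.exp_pos _).le
  rcases lt_or_ge n n₀ with hn | hn
  · -- finitely many degrees are covered by the constant `f₀`
    refine ⟨Polynomial.C f₀, by simp, Or.inl (by simp), by simpa using hrhs, fun s hre him => ?_⟩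
    rw [Polynomial.eval_C]
    have h1 : ‖F s - f₀‖ ≤ B := by
      refine (norm_sub_le _ _).trans (add_le_add_left ((hglob s).trans ?_) _)
      gcongr
    have h2 : 1 ≤ Real.exp (μ * σ * n₀) * Real.exp (-(μ * σ * n)) := by
      rw [← Real.exp_add, Real.one_le_exp_iff]
      have : (n : ℝ) ≤ n₀ := by exact_mod_cast hn.le
      have : μ * σ * n ≤ μ * σ * n₀ := by gcongr
      linarith
    calc ‖F s - f₀‖ ≤ B * 1 := by rwa [mul_one]
      _ ≤ B * (Real.exp (μ * σ * n₀) * Real.exp (-(μ * σ * n))) := by gcongr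
      _ ≤ _ := by
        rw [← mul_assoc]
        gcongr
        linarith
  · obtain ⟨h1, h2, h3, h4, h5, h6⟩ := hn₀ n hn
    set N := σ * (n : ℝ) with hN
    have hN0 : 0 ≤ N := by linarith
    obtain ⟨p, hp, hp0, hps⟩ := exists_polynomial_approx_halfStrip (G := fun s => F s - f₀)
      (hF.sub_const f₀) (A := c * (1 + N ^ b)) (a := a)
      (M := (2 * c' * (1 + N ^ b') + ‖f₀‖) * Real.exp (a' * N / 2)) (D := D) (N := N)
      (by positivity) ha h5 h6 (by
        intro ζ h7 h8
        refine (hnear ζ ((Real.exp_le_exp.2 h7).trans_lt h4)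
          (h8.trans (h3.trans (Real.exp_le_exp.2 (by nlinarith))))).trans ?_
        calc c * Real.exp (a * ζ.re) * (1 + |ζ.im| ^ b)
            ≤ c * Real.exp (a * ζ.re) * (1 + N ^ b) := by gcongr
          _ = _ := by ring) (by
        intro ζ _ h8 h9
        have hone : 1 ≤ Real.exp (a' * N / 2) := Real.one_le_exp (by positivity)
        have hexp : Real.exp (a' * ζ.re) ≤ Real.exp (a' * N / 2) :=
          Real.exp_le_exp.2 (by nlinarith)
        calc ‖F ζ - f₀‖ ≤ ‖F ζ‖ + ‖f₀‖ := norm_sub_le _ _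
          _ ≤ c' * (1 + Real.exp (a' * ζ.re)) * (1 + |ζ.im| ^ b') + ‖f₀‖ := by
            gcongr
            exact hglob ζ
          _ ≤ c' * (Real.exp (a' * N / 2) + Real.exp (a' * N / 2)) * (1 + N ^ b') +
              ‖f₀‖ * Real.exp (a' * N / 2) := by
            refine add_le_add (by gcongr) (le_mul_of_one_le_right (norm_nonneg _) hone)
          _ = _ := by ring) (n / 2)
    refine ⟨p + Polynomial.C f₀, ?_, Or.inr (by linarith), by simpa [hp0] using hrhs,
      fun s hre him => ?_⟩
    · rw [Polynomial.natDegree_add_C]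
      omega
    rw [Polynomial.eval_add, Polynomial.eval_C, ← sub_sub, sub_right_comm]
    refine (hps s hre him).trans ?_
    rw [Real.norm_eq_abs, Real.norm_eq_abs, Real.abs_exp] at h1 h2
    have hneg : Real.exp (-(μ * N)) ≤
        (1 + B * Real.exp (μ * σ * n₀)) * Real.exp (-(μ * σ * n)) := by
      rw [mul_assoc μ σ (n : ℝ), ← hN]
      exact le_mul_of_one_le_left (Real.exp_pos _).le hK1
    refine le_trans ?_ hneg
    have t1 : c * (1 + N ^ b) * (2 / a + 2 * N) * Real.exp (-(a * (N / 4))) ≤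
        1 / 2 * Real.exp (-(μ * N)) := by
      calc _ = (c + c * N ^ b) * (2 / a + 2 * N) * Real.exp (-(a * (N / 4))) := by ring
        _ ≤ 1 / 2 * Real.exp (a / 8 * N) * Real.exp (-(a * (N / 4))) := by
          exact mul_le_mul_of_nonneg_right ((le_abs_self _).trans h1) (Real.exp_pos _).le
        _ = 1 / 2 * Real.exp (-(a / 8 * N)) := by
          rw [mul_assoc, ← Real.exp_add]
          ring_nf
        _ ≤ _ := by
          gcongr
          exact min_le_left _ _
    have t2 : 4 * N * ((2 * c' * (1 + N ^ b') + ‖f₀‖) * Real.exp (a' * N / 2)) *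
        (205 / 256) ^ (n / 2) ≤ 1 / 2 * Real.exp (-(μ * N)) := by
      have hn' : (n : ℝ) = N / σ := by
        rw [hN]
        field_simp
      have hpow := pow_half_le_exp n
      rw [← hl, hn'] at hpow
      calc _ ≤ 4 * N * ((2 * c' * (1 + N ^ b') + ‖f₀‖) * Real.exp (a' * N / 2)) *
            (Real.exp l * Real.exp (-(l / 2 * (N / σ)))) := by gcongr
        _ = (2 * c' + ‖f₀‖ + 2 * c' * N ^ b') * (0 + 4 * Real.exp l * N) *
            (Real.exp (a' * N / 2) * Real.exp (-(l / 2 * (N / σ)))) := by ring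
        _ = (2 * c' + ‖f₀‖ + 2 * c' * N ^ b') * (0 + 4 * Real.exp l * N) *
            Real.exp (-(κ * N)) := by
          rw [← Real.exp_add]
          congr 2
          rw [hκ]
          field_simp
          ring
        _ ≤ 1 / 2 * Real.exp (κ / 2 * N) * Real.exp (-(κ * N)) := by
          exact mul_le_mul_of_nonneg_right ((le_abs_self _).trans h2) (Real.exp_pos _).le
        _ = 1 / 2 * Real.exp (-(κ / 2 * N)) := by
          rw [mul_assoc, ← Real.exp_add]
          ring_nf
        _ ≤ _ := by
          gcongr
          exact min_le_right _ _
    linarith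

/-- The function `f` in the coordinate `s = log z`: one entire function, which inherits the bounds
near the branch point and at infinity because every point of the wedge, and of the whole surface, is
reached by a continuation of the element. -/
theorem exists_entire_of_branchPoint {E : Set LogSurface} {f : LogSurface → ℂ} {e : FunctionElement}
    (h₁ : IsAnalyticWithBranchPoint E f e) (h₂ : HasGlobalContinuation E f e) :
    ∃ F : ℂ → ℂ, Differentiable ℂ F ∧ (∀ s, some s ∈ E → f (some s) = F s) ∧
      (∃ r > 0, ∃ τ > 0, ∃ a > 0, ∃ b > 0, ∃ c > 0, ∀ s : ℂ, Real.exp s.re < r →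
        |s.im| ≤ Real.exp (-(τ * s.re)) →
        ‖F s - f none‖ ≤ c * Real.exp (a * s.re) * (1 + |s.im| ^ (b : ℝ))) ∧
      ∃ a > 0, ∃ b > 0, ∃ c > 0, ∀ s : ℂ,
        ‖F s‖ ≤ c * (1 + Real.exp (a * s.re)) * (1 + |s.im| ^ (b : ℝ)) := by
  obtain ⟨-, r, hr, τ, hτ, hbase, hcont, -, a, ha, b, hb, c, hc, hbound⟩ := h₁
  obtain ⟨hcont', hext, a', ha', b', hb', c', hc', hbound'⟩ := h₂
  obtain ⟨F, hF, hFe⟩ := hcont'.exists_entire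
  have hpow : ∀ (x t : ℝ), Real.exp x ^ t = Real.exp (t * x) := fun x t => by
    rw [mul_comm, Real.exp_mul]
  refine ⟨F, hF, ?_, ⟨r, hr, τ, hτ, a, ha, b, hb, c, hc, ?_⟩, a', ha', b', hb', c', hc', ?_⟩
  · intro s hs
    obtain ⟨ψ, hψ, hfψ⟩ := hext s (mem_univ s) hs
    rw [hfψ.self_of_nhdsWithin hs, hψ.apply_exp hF hFe]
  · intro s h1 h2
    have hs : s ∈ wedge r τ := by
      simp only [wedge, mem_ofPred_eq, Complex.norm_exp, hpow]
      exact ⟨h1, by simpa using h2⟩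
    obtain ⟨ψ, hψ⟩ := hcont.exists_continuesTo (joinedIn_wedge hbase hs)
    have := hbound s hs ψ hψ
    rwa [hψ.apply_exp hF hFe, Complex.norm_exp, hpow] at this
  · intro s
    obtain ⟨ψ, hψ⟩ := hcont'.exists_continuesTo
      (joinedIn_univ.2 (PathConnectedSpace.joined e.base s))
    have := hbound' s ψ hψ
    rwa [hψ.apply_exp hF hFe, Complex.norm_exp, hpow] at this

theorem exists_exponential_approx {E : Set LogSurface} {f : LogSurface → ℂ} {e : FunctionElement}
    (h₁ : IsAnalyticWithBranchPoint E f e) (h₂ : HasGlobalContinuation E f e) {D : ℝ} (hD : 0 ≤ D)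
    (hE : ∀ s : ℂ, some s ∈ E → s.re ≤ D ∧ |s.im| ≤ D) :
    ∃ σ₀ > 0, ∀ σ : ℝ, 0 < σ → σ < σ₀ → ∃ C > 0, ∃ K : ℝ, ∀ n : ℕ, ∃ p : Polynomial ℂ,
      p.natDegree ≤ n ∧ (p.natDegree = 0 ∨ ∀ s : ℂ, some s ∈ E → s ≠ ((σ * n : ℝ) : ℂ)) ∧
      ‖f none - p.eval 0‖ ≤ K * Real.exp (-(C * n)) ∧
      ∀ s : ℂ, some s ∈ E →
        ‖f (some s) - p.eval (1 / (s - ((σ * n : ℝ) : ℂ)))‖ ≤ K * Real.exp (-(C * n)) := by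
  obtain ⟨F, hF, hfF, ⟨r, hr, τ, hτ, a, ha, b, hb, c, hc, hnear⟩, a', ha', b', hb', c', hc',
    hglob⟩ := exists_entire_of_branchPoint h₁ h₂
  obtain ⟨σ₀, hσ₀, h⟩ := exists_exponential_approx_halfStrip hF hr hτ ha hb hc ha' hb' hc' hD
    hnear hglob
  refine ⟨σ₀, hσ₀, fun σ h0 h1 => ?_⟩
  obtain ⟨C, hC, K, hK⟩ := h σ h0 h1
  refine ⟨C, hC, K, fun n => ?_⟩
  obtain ⟨p, hp, hdeg, hp0, hps⟩ := hK n
  refine ⟨p, hp, hdeg.imp_right fun hDn s hs hsn => ?_, hp0, fun s hs => ?_⟩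
  · have := (hE s hs).1
    rw [hsn, Complex.ofReal_re] at this
    linarith
  · rw [hfF s hs]
    exact hps s (hE s hs).1 (hE s hs).2

end RecipLog

theorem theorem4p2 :
    -- compact sets in the slit plane, with the standard branch of the logarithm
    (∀ (E : Set ℂ) (f : ℂ → ℂ) (e : RecipLog.FunctionElement),
      IsCompact E → (∀ z ∈ E, ¬ (z.re < 0 ∧ z.im = 0)) → (0 : ℂ) ∈ frontier E →
      RecipLog.IsAnalyticWithBranchPoint (RecipLog.principal '' E) (f ∘ RecipLog.proj) e →
      RecipLog.HasGlobalContinuation (RecipLog.principal '' E) (f ∘ RecipLog.proj) e →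
      ∃ σ₀ > 0, ∀ σ : ℝ, 0 < σ → σ < σ₀ →
        ∃ C > 0, ∃ K : ℝ, ∀ n : ℕ, ∃ p : Polynomial ℂ, p.natDegree ≤ n ∧
          (p.natDegree = 0 ∨ ∀ z ∈ E, z ≠ 0 → Complex.log z ≠ ((σ * n : ℝ) : ℂ)) ∧
          ‖f 0 - p.eval 0‖ ≤ K * Real.exp (-(C * n)) ∧
          ∀ z ∈ E, z ≠ 0 →
            ‖f z - p.eval (1 / (Complex.log z - ((σ * n : ℝ) : ℂ)))‖ ≤ K * Real.exp (-(C * n))) ∧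
    -- multilevel surfaces
    (∀ (E : Set RecipLog.LogSurface) (f : RecipLog.LogSurface → ℂ) (e : RecipLog.FunctionElement),
      RecipLog.IsCompactMultilevel E →
      RecipLog.IsAnalyticWithBranchPoint E f e →
      RecipLog.HasGlobalContinuation E f e →
      ∃ σ₀ > 0, ∀ σ : ℝ, 0 < σ → σ < σ₀ → RecipLog.ConvergesExponentially E f σ) := by
  refine ⟨fun E f e hcomp _ _ h₁ h₂ => ?_, fun E f e hE h₁ h₂ => ?_⟩
  · obtain ⟨R, hR⟩ := hcomp.isBounded.exists_norm_le
    have hbd : ∀ s : ℂ, some s ∈ RecipLog.principal '' E → s.re ≤ |R| + 4 ∧ |s.im| ≤ |R| + 4 := by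
      rintro s ⟨z, hz, hzs⟩
      by_cases hz0 : z = 0
      · simp [RecipLog.principal, hz0] at hzs
      · simp only [RecipLog.principal, if_neg hz0, Option.some.injEq] at hzs
        rw [← hzs, Complex.log_re, Complex.log_im]
        have h1 := Real.log_le_sub_one_of_pos (norm_pos_iff.2 hz0)
        have h2 := hR z hz
        have h3 := Complex.abs_arg_le_pi z
        have h4 := Real.pi_le_four
        have h5 := le_abs_self R
        have h6 := abs_nonneg R
        constructor <;> linarith
    obtain ⟨σ₀, hσ₀, h⟩ := RecipLog.exists_exponential_approx h₁ h₂ (by positivity) hbd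
    have hmem : ∀ z ∈ E, z ≠ 0 → some (Complex.log z) ∈ RecipLog.principal '' E :=
      fun z hz hz0 => ⟨z, hz, by simp [RecipLog.principal, hz0]⟩
    refine ⟨σ₀, hσ₀, fun σ h0 h1 => ?_⟩
    obtain ⟨C, hC, K, hK⟩ := h σ h0 h1
    refine ⟨C, hC, K, fun n => ?_⟩
    obtain ⟨p, hp, hdeg, hp0, hps⟩ := hK n
    refine ⟨p, hp, hdeg.imp_right fun hne z hz hz0 => hne _ (hmem z hz hz0), hp0,
      fun z hz hz0 => ?_⟩
    have := hps _ (hmem z hz hz0)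
    rwa [Function.comp_apply, RecipLog.proj, Complex.exp_log hz0] at this
  · obtain ⟨R, hR⟩ := hE.bounded
    obtain ⟨L, hL⟩ := hE.finite_wrapping
    have hbd : ∀ s : ℂ, some s ∈ E → s.re ≤ |R| + |L| ∧ |s.im| ≤ |R| + |L| := by
      intro s hs
      have h1 := hR s hs
      rw [Complex.norm_exp] at h1
      have h2 := Real.add_one_le_exp s.re
      have h3 := hL s hs
      have h4 := le_abs_self R
      have h5 := le_abs_self L
      have h6 := abs_nonneg R
      have h7 := abs_nonneg L
      constructor <;> linarith
    obtain ⟨σ₀, hσ₀, h⟩ := RecipLog.exists_exponential_approx h₁ h₂ (by positivity) hbd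
    refine ⟨σ₀, hσ₀, fun σ h0 h1 => ?_⟩
    obtain ⟨C, hC, K, hK⟩ := h σ h0 h1
    refine ⟨C, hC, K, fun n => ?_⟩
    obtain ⟨p, hp, hdeg, hp0, hps⟩ := hK n
    refine ⟨p, hp, hdeg.imp_right fun hne hmem => hne _ hmem rfl, ?_⟩
    rintro (_ | s) hx
    · exact hp0
    · exact hps s hx
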